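/- Let $\mathbb K$ be $\mathbb R$ or $\mathbb C$, and let $\varphi$ be the $\mathbb K$-vector space of all finitely supported sequences of elements of $\mathbb K$ (a space of countably infinite algebraic dimension). Assume the Continuum Hypothesis $2^{\aleph_0}=\aleph_1$. Then there is a complete Hausdorff locally convex vector space topology on $\varphi$ such that: (a) $\varphi$ is strongly orbital, that is, there are a continuous linear operator $T:\varphi\to\varphi$ and a vector $x\in\varphi$ such that the orbit $\{T^nx : n=0,1,2,\dots\}$ is dense in $\varphi$ and its linear span is all of $\varphi$; (b) consequently, $\varphi$ does not have the invariant subset property, that is, there is a continuous linear operator $T:\varphi\to\varphi$ for which the only closed sets $S\subseteq\varphi$ with $T(S)\subseteq S$ are $\emptyset$, $\{0\}$ and $\varphi$. -/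

import Mathlib

/-- The orbit `O(T, x) = {T ^ n x : n = 0, 1, 2, …}`. -/
def operatorOrbit {𝕜 X : Type*} [Semiring 𝕜] [AddCommMonoid X] [Module 𝕜 X]
    [TopologicalSpace X] (T : X →L[𝕜] X) (x : X) : Set X :=
  Set.range fun n : ℕ => (T ^ n) x

/-- `x` is a hypercyclic vector for `T` if its orbit is dense. -/
def IsHypercyclicVector {𝕜 X : Type*} [Semiring 𝕜] [AddCommMonoid X] [Module 𝕜 X]
    [TopologicalSpace X] (T : X →L[𝕜] X) (x : X) : Prop :=
  Dense (operatorOrbit T x)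

/-- `X` is strongly orbital if some continuous linear operator has a hypercyclic vector
whose orbit has linear span (not merely closed linear span) equal to `X`. -/
def IsStronglyOrbital (𝕜 X : Type*) [Semiring 𝕜] [AddCommMonoid X] [Module 𝕜 X]
    [TopologicalSpace X] : Prop :=
  ∃ (T : X →L[𝕜] X) (x : X),
    IsHypercyclicVector T x ∧ Submodule.span 𝕜 (operatorOrbit T x) = ⊤

/-- `X` has the invariant subset property if every continuous linear operator on `X` has a closed
invariant subset different from `∅`, `{0}` and `X`. -/
def HasInvariantSubsetProperty (𝕜 X : Type*) [Semiring 𝕜] [AddCommMonoid X] [Module 𝕜 X]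
    [TopologicalSpace X] : Prop :=
  ∀ T : X →L[𝕜] X, ∃ S : Set X,
    IsClosed S ∧ Set.MapsTo T S S ∧ S ≠ ∅ ∧ S ≠ {0} ∧ S ≠ Set.univ

/-!
The space is built inside `E = ℕ → 𝕜`, on which the backward shift `S` has a vector `a` with dense
orbit. Finitely supported sequences are identified with the span of that orbit by
`orbitMap S a : single n 1 ↦ S ^ n a`; under this identification `S` becomes the right shift
`finsuppShift`, whose orbit at `single 0 1` spans everything. What remains is to refine the topology
inherited from `E` until it is complete, without destroying the density of the orbit.

A sequence `g` of continuous functionals on `E` which vanishes eventually at each vector of the span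
(`NullFunctionals`) yields the seminorms `u ↦ sup_i ‖g i (S ^ k (orbitMap S a u))‖`. Each is lower
semicontinuous for the topology of `E`, and if `‖g i y‖` is unbounded, then `y ∈ E` cannot be the
limit of a net from the span which is Cauchy for the refined topology. So the topology given by a
set `D` of such sequences is complete once every `y` outside the span is excluded in this way by a
member of `D`: the space then embeds in a product of complete spaces, with a range that is cut out
by closed conditions (`range_finsuppEmbedding`).

The crux is `HasDenseOrbit.exists_insert`: when `D` is countable and the orbit is dense for the
topology given by `D`, any `y` outside the span can be excluded by one more sequence `g` with the
orbit still dense. There are countably many density requirements. The `i`-th is met by a vector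
`single m 1 - v` that is small for `D` and for the functionals `g j`, `j < i`, already chosen; all
later functionals are made to vanish on it and on its first shifts. This prescribes zeros on a
finite-dimensional subspace of the span only, and `y` is not in it, so `g i y = i` is possible.

By the Continuum Hypothesis `E` is enumerated along `ω₁`, whose initial segments are countable, and
transfinite recursion excludes all `y` outside the span
(`exists_set_of_finite_character`, `exists_hasDenseOrbit`).

The invariant subset property fails because every nonzero vector is hypercyclic as soon as the orbit
of one hypercyclic vector `x` spans (`IsHypercyclicVector.of_ne_zero`). A closed invariant subspace
`N` containing `p(T) x` with `p ≠ 0` gives a finite-dimensional algebra `𝕜[X] ⧸ I ≃ X ⧸ N`.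
Its norm is a continuous function on `X` with the values `δ ^ n` along the orbit of `x`; if `N` is
proper, this is incompatible with the values `0` at `0` and `2 ^ d`, `d > 0`, at `2 • x`.
-/

open Filter Topology Polynomial
open scoped BoundedContinuousFunction

/-! ### Recursion along a well-order -/

/-- Well-founded recursion with choices: `R i f x` says that `x` is an admissible value at `i` when
the earlier values are those of `f`. -/
theorem WellFounded.exists_forall_rel {ι α : Type*} [Nonempty α] {r : ι → ι → Prop}
    (hr : WellFounded r) (R : ι → (ι → α) → α → Prop)
    (hcongr : ∀ i f f' x, (∀ j, r j i → f j = f' j) → R i f x → R i f' x)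
    (hex : ∀ i f, (∀ j, r j i → R j f (f j)) → ∃ x, R i f x) :
    ∃ f : ι → α, ∀ i, R i f (f i) := by
  classical
  let ext : ∀ i, (∀ j, r j i → α) → ι → α := fun i h j =>
    if hj : r j i then h j hj else Classical.arbitrary α
  let f : ι → α := hr.fix fun i h => Classical.epsilon (R i (ext i h))
  refine ⟨f, fun i => ?_⟩
  induction i using hr.induction with
  | _ i ih =>
    have hf : f i = Classical.epsilon (R i (ext i fun j _ => f j)) := hr.fix_eq _ i
    have hagree : ∀ j, r j i → f j = ext i (fun j _ => f j) j := fun j hj => by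
      simp [ext, hj]
    obtain ⟨x, hx⟩ := hex i f ih
    rw [hf]
    exact hcongr i _ _ _ (fun j hj => (hagree j hj).symm)
      (Classical.epsilon_spec ⟨x, hcongr i _ _ _ hagree hx⟩)

/-- If `P` is of finite character and a countable set with `P` can always be enlarged by an element
that serves `i`, then a well-order with countable initial segments allows all `i` to be served. -/
theorem exists_set_of_finite_character {α ι : Type*} [Nonempty α] [LinearOrder ι]
    [WellFoundedLT ι] (hι : ∀ i : ι, (Set.Iio i).Countable) (P : Set α → Prop)
    (Q : ι → α → Prop) (hempty : P ∅) (hmono : ∀ D D', D ⊆ D' → P D' → P D)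
    (hfin : ∀ D, (∀ F ⊆ D, F.Finite → P F) → P D)
    (hstep : ∀ D : Set α, D.Countable → P D → ∀ i, ∃ g, Q i g ∧ P (insert g D)) :
    ∃ D, P D ∧ ∀ i, ∃ g ∈ D, Q i g := by
  -- A finite subset of an image lies in the part indexed up to its largest index, so `P` passes to
  -- unions along the order.
  have key : ∀ (f : ι → α) (s : Set ι), (∀ i ∈ s, P (insert (f i) (f '' Set.Iio i))) →
      P (f '' s) := by
    intro f s hs
    refine hfin _ fun F hF hFf => ?_
    obtain ⟨t, hts, rfl⟩ := Set.subset_image_iff.1 hF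
    obtain ⟨u, hut, huf⟩ := Set.exists_subset_bijOn t f
    have hufin : u.Finite := huf.finite_iff_finite.2 hFf
    rw [← huf.image_eq]
    rcases u.eq_empty_or_nonempty with rfl | hne
    · simpa using hempty
    obtain ⟨i, hi, hmax⟩ := Set.exists_max_image u id hufin hne
    refine hmono _ _ ?_ (hs i (hts (hut hi)))
    rintro _ ⟨j, hj, rfl⟩
    rcases (hmax j hj).eq_or_lt with h | h
    · exact Or.inl (congrArg f h)
    · exact Or.inr ⟨j, h, rfl⟩
  obtain ⟨f, hf⟩ := (wellFounded_lt (α := ι)).exists_forall_rel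
    (fun i (f : ι → α) x => Q i x ∧ P (insert x (f '' Set.Iio i)))
    (fun i f f' x h hx => by
      have : f '' Set.Iio i = f' '' Set.Iio i := Set.image_congr fun j hj => h j hj
      rwa [← this])
    (fun i f h => hstep _ ((hι i).image f) (key f _ fun j hj => (h j hj).2) i)
  refine ⟨Set.range f, ?_, fun i => ⟨f i, ⟨i, rfl⟩, (hf i).1⟩⟩
  rw [← Set.image_univ]
  exact key f _ fun i _ => (hf i).2

/-! ### Functionals vanishing on finite sets -/

theorem SeparatingDual.exists_eq_zero_of_notMem {𝕜 E : Type*} [RCLike 𝕜] [AddCommGroup E]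
    [Module 𝕜 E] [TopologicalSpace E] [SeparatingDual 𝕜 E] {s : Set E} (hs : s.Finite) {y : E}
    (hy : y ∉ Submodule.span 𝕜 s) (c : 𝕜) :
    ∃ h : E →L[𝕜] 𝕜, (∀ x ∈ s, h x = 0) ∧ h y = c := by
  obtain ⟨f, hfy, hf⟩ := Submodule.exists_dual_map_eq_bot_of_notMem hy inferInstance
  let W := Submodule.span 𝕜 (insert y s)
  have : FiniteDimensional 𝕜 W := FiniteDimensional.span_of_finite 𝕜 (hs.insert y)
  obtain ⟨h, hh⟩ := (SeparatingDual.dualMap_surjective_iff (f := W.subtype)).2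
    W.injective_subtype ((c / f y) • f.comp W.subtype)
  have hval : ∀ x ∈ insert y s, h x = c / f y * f x := fun x hx => by
    simpa using LinearMap.congr_fun hh ⟨x, Submodule.subset_span hx⟩
  refine ⟨h, fun x hx => ?_, ?_⟩
  · have : f x = 0 := by
      have := Submodule.mem_map_of_mem (f := f) (Submodule.subset_span (R := 𝕜) hx)
      rwa [hf, Submodule.mem_bot] at this
    rw [hval x (Or.inr hx), this, mul_zero]
  · rw [hval y (Or.inl rfl), div_mul_cancel₀ _ hfy]

/-! ### Hypercyclic vectors whose orbit spans -/

section
variable {𝕜 X : Type*} [RCLike 𝕜] [AddCommGroup X] [Module 𝕜 X] [TopologicalSpace X]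
  [IsTopologicalAddGroup X] [ContinuousSMul 𝕜 X]

theorem Polynomial.finite_quotient_of_mem {K : Type*} [Field K] {I : Ideal K[X]} {p : K[X]}
    (hp : p ≠ 0) (hpI : p ∈ I) : Module.Finite K (K[X] ⧸ I) := by
  have : Module.Finite K (K[X] ⧸ Ideal.span {p}) := (AdjoinRoot.powerBasis hp).finite
  have hle : Ideal.span {p} ≤ I := (Ideal.span_singleton_le_iff_mem I).2 hpI
  exact Module.Finite.of_surjective (Ideal.Quotient.factorₐ K hle).toLinearMap
    (Ideal.Quotient.factor_surjective hle)

theorem exists_aeval_apply_eq {T : X →L[𝕜] X} {x : X}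
    (hspan : Submodule.span 𝕜 (operatorOrbit T x) = ⊤) (v : X) :
    ∃ q : 𝕜[X], aeval T q x = v := by
  have hv : v ∈ Submodule.span 𝕜 (operatorOrbit T x) := hspan ▸ Submodule.mem_top
  induction hv using Submodule.span_induction with
  | mem u hu =>
    obtain ⟨n, rfl⟩ := hu
    exact ⟨Polynomial.X ^ n, by simp⟩
  | zero => exact ⟨0, by simp⟩
  | add u v _ _ hu hv =>
    obtain ⟨q, rfl⟩ := hu
    obtain ⟨r, rfl⟩ := hv
    exact ⟨q + r, by simp⟩
  | smul c u _ hu =>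
    obtain ⟨q, rfl⟩ := hu
    exact ⟨c • q, by simp⟩

/-- Multiplication by `T` on the finite-dimensional algebra `𝕜[X] ⧸ I ≃ X ⧸ N` would be hypercyclic
if `N` were proper; the algebra norm shows that this is impossible over `ℝ` as well as over `ℂ`. -/
theorem IsHypercyclicVector.eq_top_of_mem {T : X →L[𝕜] X} {x : X} (hx : IsHypercyclicVector T x)
    (hspan : Submodule.span 𝕜 (operatorOrbit T x) = ⊤) {N : Submodule 𝕜 X}
    (hN : IsClosed (N : Set X)) (hTN : ∀ u ∈ N, T u ∈ N) {p : 𝕜[X]} (hp : p ≠ 0)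
    (hpN : aeval T p x ∈ N) : N = ⊤ := by
  have hstable : ∀ (q : 𝕜[X]), ∀ u ∈ N, aeval T q u ∈ N := by
    intro q
    induction q using Polynomial.induction_on' with
    | add q r hq hr => intro u hu; simpa using N.add_mem (hq u hu) (hr u hu)
    | monomial n c =>
      have hpow : ∀ u ∈ N, (T ^ n) u ∈ N := by
        induction n with
        | zero => intro u hu; simpa using hu
        | succ n ih => intro u hu; rw [pow_succ]; exact ih _ (hTN u hu)
      intro u hu
      simpa [aeval_monomial, ← Algebra.smul_def] using N.smul_mem c (hpow u hu)
  let ev : 𝕜[X] →ₗ[𝕜] X ⧸ N :=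
    { toFun := fun q => N.mkQ (aeval T q x)
      map_add' := fun q r => by simp
      map_smul' := fun c q => by simp }
  have hev : ∀ q, ev q = N.mkQ (aeval T q x) := fun q => rfl
  let I : Ideal 𝕜[X] :=
    { carrier := {q | aeval T q x ∈ N}
      add_mem' := fun {q r} hq hr => by simpa using N.add_mem hq hr
      zero_mem' := by simp
      smul_mem' := fun q r hr => by simpa using hstable q _ hr }
  have hker : LinearMap.ker ev = I.restrictScalars 𝕜 := by
    ext q
    rw [LinearMap.mem_ker, hev, Submodule.mkQ_apply, Submodule.Quotient.mk_eq_zero]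
    rfl
  have hsurj : Function.Surjective ev := by
    intro w
    obtain ⟨u, rfl⟩ := N.mkQ_surjective w
    obtain ⟨q, rfl⟩ := exists_aeval_apply_eq hspan u
    exact ⟨q, rfl⟩
  by_contra hNtop
  have hfin : Module.Finite 𝕜 (𝕜[X] ⧸ I) := Polynomial.finite_quotient_of_mem hp hpN
  have hnontriv : Nontrivial (𝕜[X] ⧸ I) := by
    refine Ideal.Quotient.nontrivial_iff.2 fun htop => hNtop ?_
    rw [eq_top_iff, ← hspan, Submodule.span_le]
    rintro _ ⟨n, rfl⟩
    have : (Polynomial.X ^ n : 𝕜[X]) ∈ I := htop ▸ Submodule.mem_top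
    simpa [I] using this
  let θ : (𝕜[X] ⧸ I) ≃ₗ[𝕜] X ⧸ N :=
    (Submodule.Quotient.restrictScalarsEquiv 𝕜 I).symm ≪≫ₗ
      Submodule.quotEquivOfEq _ _ hker.symm ≪≫ₗ ev.quotKerEquivOfSurjective hsurj
  have hθ : ∀ q : 𝕜[X], θ (Ideal.Quotient.mk I q) = N.mkQ (aeval T q x) := fun q => rfl
  have : FiniteDimensional 𝕜 (X ⧸ N) := Module.Finite.equiv θ
  have : IsClosed (N : Set X) := hN
  let b := Module.finBasis 𝕜 (𝕜[X] ⧸ I)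
  let M : X ⧸ N →ₗ[𝕜] Matrix _ _ 𝕜 := (Algebra.leftMulMatrix b).toLinearMap ∘ₗ θ.symm.toLinearMap
  have hMcont : Continuous M := M.continuous_of_finiteDimensional
  let D : X → 𝕜 := fun u => (M (N.mkQ u)).det
  have hDcont : Continuous D := (hMcont.comp continuous_quot_mk).matrix_det
  have hD : ∀ q : 𝕜[X], D (aeval T q x) = Algebra.norm 𝕜 (Ideal.Quotient.mk I q) := by
    intro q
    simp only [D, M, ← hθ, Algebra.norm_eq_matrix_det b]
    simp
  set δ := Algebra.norm 𝕜 (Ideal.Quotient.mk I Polynomial.X) with hδ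
  have hDpow : ∀ n, D ((T ^ n) x) = δ ^ n := fun n => by
    simpa using hD (Polynomial.X ^ n)
  have hD0 : D 0 = 0 := by simpa using hD 0
  have hD2 : 1 < ‖D ((2 : 𝕜) • x)‖ := by
    have h := hD (C 2)
    rw [aeval_C, Algebra.algebraMap_eq_smul_one, smul_apply, one_apply_eq_self] at h
    have h2 : Ideal.Quotient.mk I (C (2 : 𝕜)) = algebraMap 𝕜 (𝕜[X] ⧸ I) 2 := rfl
    rw [h, h2, Algebra.norm_algebraMap, norm_pow, RCLike.norm_two]
    exact one_lt_pow₀ one_lt_two Module.finrank_pos.ne'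
  have hclosed : ∀ s : Set X, IsClosed s → (∀ n, (T ^ n) x ∈ s) → s = Set.univ := by
    intro s hs hsx
    rw [← hs.closure_eq]
    exact (hx.mono (by rintro _ ⟨n, rfl⟩; exact hsx n)).closure_eq
  -- `‖D‖` is at most `1` or at least `1` on the dense orbit, hence everywhere; but it is `0` at `0`
  -- and exceeds `1` at `2 • x`.
  rcases le_total ‖δ‖ 1 with h | h
  · have := hclosed {u | ‖D u‖ ≤ 1} (isClosed_le hDcont.norm continuous_const) fun n => by
      simpa only [Set.mem_ofPred_eq, hDpow, norm_pow] using pow_le_one₀ (norm_nonneg δ) h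
    exact absurd (this ▸ Set.mem_univ ((2 : 𝕜) • x) : (2 : 𝕜) • x ∈ {u | ‖D u‖ ≤ 1}) hD2.not_ge
  · have := hclosed {u | 1 ≤ ‖D u‖} (isClosed_le continuous_const hDcont.norm) fun n => by
      simpa only [Set.mem_ofPred_eq, hDpow, norm_pow] using one_le_pow₀ h
    have h0 : (0 : X) ∈ {u | 1 ≤ ‖D u‖} := this ▸ Set.mem_univ _
    simp [hD0] at h0
    linarith

/-- If `u = p(T) x` with `p ≠ 0`, then `p(T)` has dense range, so it maps the dense orbit of `x` to a
dense set, which is the orbit of `u`. -/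
theorem IsHypercyclicVector.of_ne_zero {T : X →L[𝕜] X} {x : X} (hx : IsHypercyclicVector T x)
    (hspan : Submodule.span 𝕜 (operatorOrbit T x) = ⊤) {u : X} (hu : u ≠ 0) :
    IsHypercyclicVector T u := by
  obtain ⟨p, rfl⟩ := exists_aeval_apply_eq hspan u
  have hp : p ≠ 0 := by rintro rfl; simp at hu
  have hcomm : ∀ (q : 𝕜[X]) (v : X), aeval T p (aeval T q v) = aeval T q (aeval T p v) := by
    intro q v
    rw [← mul_apply_eq_comp, ← mul_apply_eq_comp, ← map_mul, ← map_mul, mul_comm]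
  have hTcomm : ∀ v, aeval T p (T v) = T (aeval T p v) := fun v => by
    simpa using hcomm Polynomial.X v
  let R : Submodule 𝕜 X := LinearMap.range (aeval T p).toLinearMap
  have htop : R.topologicalClosure = ⊤ := by
    refine hx.eq_top_of_mem hspan R.isClosed_topologicalClosure ?_ hp
      (R.le_topologicalClosure ⟨x, rfl⟩)
    have : Set.MapsTo T (R : Set X) R := by
      rintro _ ⟨v, rfl⟩
      exact ⟨T v, hTcomm v⟩
    exact this.closure T.continuous
  have hrange : DenseRange (aeval T p) := by
    rw [DenseRange, dense_iff_closure_eq]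
    exact congrArg (fun s : Submodule 𝕜 X => (s : Set X)) htop
  refine (hrange.dense_image (aeval T p).continuous hx).mono ?_
  rintro _ ⟨_, ⟨n, rfl⟩, rfl⟩
  exact ⟨n, by simpa using (hcomm (Polynomial.X ^ n) x).symm⟩

theorem IsStronglyOrbital.not_hasInvariantSubsetProperty (h : IsStronglyOrbital 𝕜 X) :
    ¬ HasInvariantSubsetProperty 𝕜 X := by
  intro hinv
  obtain ⟨T, x, hx, hspan⟩ := h
  obtain ⟨s, hs, hTs, hne, hne0, hneuniv⟩ := hinv T
  obtain ⟨u, hus, hu⟩ : ∃ u ∈ s, u ≠ 0 := by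
    by_contra! hcon
    exact hne0 ((Set.nonempty_iff_ne_empty.2 hne).subset_singleton_iff.1 hcon)
  refine hneuniv ?_
  rw [← hs.closure_eq]
  refine ((hx.of_ne_zero hspan hu).mono ?_).closure_eq
  rintro _ ⟨n, rfl⟩
  have := hTs.iterate n hus
  rwa [← FunLike.coe_pow_eq_iterate] at this

end

/-! ### Sequences of functionals and the topologies they define -/

section
variable {𝕜 E : Type*} [RCLike 𝕜] [AddCommGroup E] [Module 𝕜 E] [TopologicalSpace E]
  (S : E →L[𝕜] E) (a : E)

/-- The right shift of finitely supported sequences, `single n c ↦ single (n + 1) c`. -/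
noncomputable def finsuppShift (𝕜 : Type*) [Semiring 𝕜] : (ℕ →₀ 𝕜) →ₗ[𝕜] (ℕ →₀ 𝕜) :=
  Finsupp.lmapDomain 𝕜 𝕜 Nat.succ

theorem finsuppShift_pow_single (k n : ℕ) (c : 𝕜) :
    (finsuppShift 𝕜 ^ k) (Finsupp.single n c) = Finsupp.single (n + k) c := by
  induction k with
  | zero => rfl
  | succ k ih =>
    rw [pow_succ', Module.End.mul_apply, ih, finsuppShift, Finsupp.lmapDomain_apply,
      Finsupp.mapDomain_single, Nat.add_succ]

/-- The linear map `single n c ↦ c • S ^ n a`, which carries the right shift to `S` and has the span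
of the orbit of `a` as its range. -/
noncomputable def orbitMap : (ℕ →₀ 𝕜) →ₗ[𝕜] E :=
  Finsupp.linearCombination 𝕜 fun n => (S ^ n) a

theorem orbitMap_single (n : ℕ) (c : 𝕜) :
    orbitMap S a (Finsupp.single n c) = c • (S ^ n) a := by
  simp [orbitMap]

theorem orbitMap_finsuppShift_pow (k : ℕ) (u : ℕ →₀ 𝕜) :
    orbitMap S a ((finsuppShift 𝕜 ^ k) u) = (S ^ k) (orbitMap S a u) := by
  induction u using Finsupp.induction_linear with
  | zero => simp
  | add u v hu hv => simp only [map_add, hu, hv]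
  | single n c =>
    rw [finsuppShift_pow_single, orbitMap_single, orbitMap_single, map_smul, add_comm, pow_add,
      mul_apply_eq_comp]

/-- Sequences of continuous functionals on `E` which vanish eventually at each vector of the span of
the orbit of `a`. -/
def NullFunctionals : Type _ :=
  {g : ℕ → E →L[𝕜] 𝕜 // ∀ u : ℕ →₀ 𝕜, ∀ᶠ i in atTop, g i (orbitMap S a u) = 0}

variable {S a}

/-- The bounded sequence `i ↦ g i (orbitMap S a u)`, linearly in `u`. -/
noncomputable def NullFunctionals.eval (g : NullFunctionals S a) : (ℕ →₀ 𝕜) →ₗ[𝕜] (ℕ →ᵇ 𝕜) where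
  toFun u := ⟨⟨fun i => g.1 i (orbitMap S a u), continuous_of_discreteTopology⟩, by
    obtain ⟨N, hN⟩ := eventually_atTop.1 (g.2 u)
    have hfin : (Set.range fun i => g.1 i (orbitMap S a u)).Finite := by
      refine ((Set.finite_Iio N).image (fun i => g.1 i (orbitMap S a u)) |>.insert 0).subset ?_
      rintro _ ⟨i, rfl⟩
      rcases lt_or_ge i N with h | h
      · exact Or.inr ⟨i, h, rfl⟩
      · exact Or.inl (hN i h)
    obtain ⟨C, hC⟩ := Metric.isBounded_iff.1 hfin.isBounded
    exact ⟨C, fun i j => hC ⟨i, rfl⟩ ⟨j, rfl⟩⟩⟩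
  map_add' u v := by ext i; simp
  map_smul' c u := by ext i; simp

@[simp]
theorem NullFunctionals.eval_apply (g : NullFunctionals S a) (u : ℕ →₀ 𝕜) (i : ℕ) :
    g.eval u i = g.1 i (orbitMap S a u) := rfl

/-- Density of `{single m 1 : m ∈ ℕ}`, the orbit of `single 0 1` under the right shift, for the
topology generated by `orbitMap S a` and the seminorms `u ↦ ‖g.eval (finsuppShift ^ k u)‖` with
`g ∈ D` and `k ∈ ℕ`. It is spelled out with finitely many seminorms at a time, which makes it a
property of finite character of `D`. -/
def HasDenseOrbit (D : Set (NullFunctionals S a)) : Prop :=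
  ∀ v : ℕ →₀ 𝕜, ∀ U ∈ 𝓝 (0 : E), ∀ F : Finset (NullFunctionals S a), ↑F ⊆ D → ∀ K : ℕ, ∀ ε > 0,
    ∃ m : ℕ, orbitMap S a (Finsupp.single m 1 - v) ∈ U ∧
      ∀ g ∈ F, ∀ k ≤ K, ‖g.eval ((finsuppShift 𝕜 ^ k) (Finsupp.single m 1 - v))‖ ≤ ε

variable (𝕜) in
/-- An enumeration, by lists, of the finite sums of vectors `single n q` with `q` in a fixed
countable dense subset of `𝕜`. -/
noncomputable def listVector (l : List (ℕ × ℕ)) : ℕ →₀ 𝕜 :=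
  (l.map fun p => Finsupp.single p.1 (TopologicalSpace.denseSeq 𝕜 p.2)).sum

variable [IsTopologicalAddGroup E] [ContinuousSMul 𝕜 E]

/-- The vectors `listVector l` are dense for every vector space topology; this is phrased through a
linear map so that no topology has to be put on `ℕ →₀ 𝕜`. -/
theorem mem_closure_image_listVector {Y : Type*} [AddCommGroup Y] [Module 𝕜 Y]
    [TopologicalSpace Y] [IsTopologicalAddGroup Y] [ContinuousSMul 𝕜 Y]
    (f : (ℕ →₀ 𝕜) →ₗ[𝕜] Y) (v : ℕ →₀ 𝕜) :
    f v ∈ closure (Set.range fun l => f (listVector 𝕜 l)) := by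
  induction v using Finsupp.induction_linear with
  | zero => exact subset_closure ⟨[], by simp [listVector]⟩
  | add u v hu hv =>
    rw [map_add]
    refine map_mem_closure₂ continuous_add hu hv ?_
    rintro _ ⟨l, rfl⟩ _ ⟨l', rfl⟩
    exact ⟨l ++ l', by simp [listVector]⟩
  | single n c =>
    have hcont : Continuous fun c : 𝕜 => c • f (Finsupp.single n 1) := by fun_prop
    have hc := TopologicalSpace.denseRange_denseSeq 𝕜 c
    have := map_mem_closure hcont hc (t := Set.range fun l => f (listVector 𝕜 l)) (by
      rintro _ ⟨j, rfl⟩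
      refine ⟨[(n, j)], ?_⟩
      simp [listVector, ← map_smul])
    simpa [← map_smul] using this

theorem exists_listVector_near (v : ℕ →₀ 𝕜) {U : Set E} (hU : U ∈ 𝓝 0)
    (F : Finset (NullFunctionals S a)) (K : ℕ) {ε : ℝ} (hε : 0 < ε) :
    ∃ l, orbitMap S a (listVector 𝕜 l - v) ∈ U ∧
      ∀ g ∈ F, ∀ k ≤ K, ‖g.eval ((finsuppShift 𝕜 ^ k) (listVector 𝕜 l - v))‖ ≤ ε := by
  let f : (ℕ →₀ 𝕜) →ₗ[𝕜] E × (NullFunctionals S a × ℕ → ℕ →ᵇ 𝕜) :=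
    (orbitMap S a).prod (LinearMap.pi fun p => p.1.eval ∘ₗ (finsuppShift 𝕜 ^ p.2))
  have hnhds : ∀ᶠ z in 𝓝 (f v), z.1 - (f v).1 ∈ U ∧
      ∀ g ∈ F, ∀ k ∈ Finset.range (K + 1), ‖z.2 (g, k) - (f v).2 (g, k)‖ < ε := by
    refine Eventually.and ?_ ((F.eventually_all).2 fun g _ => (Finset.eventually_all _).2
      fun k _ => ?_)
    · have : Tendsto (fun z => z.1 - (f v).1) (𝓝 (f v)) (𝓝 0) := by
        have h : Continuous fun z : E × (NullFunctionals S a × ℕ → ℕ →ᵇ 𝕜) => z.1 - (f v).1 := by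
          fun_prop
        simpa using h.tendsto (f v)
      exact this hU
    · have h : Continuous fun z : E × (NullFunctionals S a × ℕ → ℕ →ᵇ 𝕜) =>
          ‖z.2 (g, k) - (f v).2 (g, k)‖ := by fun_prop
      exact h.continuousAt.eventually_lt continuousAt_const (by simpa using hε)
  obtain ⟨_, h, l, rfl⟩ := mem_closure_iff_nhds.1 (mem_closure_image_listVector f v) _ hnhds
  refine ⟨l, by simpa [f] using h.1, fun g hg k hk => ?_⟩
  have : ‖g.eval ((finsuppShift 𝕜 ^ k) (listVector 𝕜 l)) - g.eval ((finsuppShift 𝕜 ^ k) v)‖ ≤ ε :=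
    (h.2 g hg k (Finset.mem_range.2 (Nat.lt_succ_of_le hk))).le
  rwa [map_sub, map_sub]

end

/-! ### Excluding vectors outside the span -/

section
variable {𝕜 E : Type*} [RCLike 𝕜] [AddCommGroup E] [Module 𝕜 E] [TopologicalSpace E]
  {S : E →L[𝕜] E} {a : E}

theorem exists_functional_vanishing [SeparatingDual 𝕜 E] {s : Set (ℕ →₀ 𝕜)} (hs : s.Finite)
    (y : E) (c : 𝕜) :
    ∃ h : E →L[𝕜] 𝕜, (∀ u ∈ s, h (orbitMap S a u) = 0) ∧
      (y ∉ LinearMap.range (orbitMap S a) → h y = c) := by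
  by_cases hy : y ∈ LinearMap.range (orbitMap S a)
  · exact ⟨0, by simp, fun h => absurd hy h⟩
  · obtain ⟨h, h0, hc⟩ := SeparatingDual.exists_eq_zero_of_notMem (𝕜 := 𝕜)
      (hs.image (orbitMap S a)) (y := y) (fun hmem => hy (Submodule.span_le.2 (by
        rintro _ ⟨u, _, rfl⟩
        exact ⟨u, rfl⟩) hmem)) c
    exact ⟨h, fun u hu => h0 _ ⟨u, hu, rfl⟩, fun _ => hc⟩

variable [IsTopologicalAddGroup E]

/-- Adding to `D` a suitable sequence that is unbounded at `y` keeps the orbit dense. -/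
theorem HasDenseOrbit.exists_insert [ContinuousSMul 𝕜 E] [FirstCountableTopology E]
    [SeparatingDual 𝕜 E]
    {D : Set (NullFunctionals S a)} (hcount : D.Countable) (hD : HasDenseOrbit D) (y : E) :
    ∃ g : NullFunctionals S a,
      (y ∉ LinearMap.range (orbitMap S a) → ∀ i, g.1 i y = i) ∧ HasDenseOrbit (insert g D) := by
  classical
  have : Countable D := hcount
  obtain ⟨B, hB⟩ := (𝓝 (0 : E)).exists_antitone_basis
  obtain ⟨ρ, hρ⟩ := exists_surjective_nat (List (ℕ × ℕ) × ℕ × Finset D)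
  let T := finsuppShift 𝕜
  -- The requirement with number `i` is `ρ i = (l, K, F)`: approximate `listVector l` up to `B K` and,
  -- for the seminorms given by `F` or by the new sequence and by `k ≤ K`, up to `1 / (K + 1)`.
  let w : ℕ → ℕ → ℕ →₀ 𝕜 := fun i m => Finsupp.single m 1 - listVector 𝕜 (ρ i).1
  let K : ℕ → ℕ := fun i => (ρ i).2.1
  let δ : ℕ → ℝ := fun i => 1 / ((K i : ℝ) + 1)
  have hδ : ∀ i, 0 < δ i := fun i => Nat.one_div_pos_of_nat
  -- `f i` consists of the exponent meeting requirement `i` and of the new functional with index `i`.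
  -- The third clause controls the functionals before `i` on the vector of requirement `i`; by the
  -- fourth and fifth, functional `i` vanishes on the vectors of requirement `i` and of all earlier ones.
  let R : ℕ → (ℕ → ℕ × (E →L[𝕜] 𝕜)) → ℕ × (E →L[𝕜] 𝕜) → Prop := fun i f x =>
    orbitMap S a (w i x.1) ∈ B (K i) ∧
    (∀ g ∈ (ρ i).2.2, ∀ k ≤ K i, ‖g.1.eval ((T ^ k) (w i x.1))‖ ≤ δ i) ∧
    (∀ j < i, ∀ k ≤ K i, ‖(f j).2 (orbitMap S a ((T ^ k) (w i x.1)))‖ ≤ δ i) ∧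
    (∀ k ≤ K i, x.2 (orbitMap S a ((T ^ k) (w i x.1))) = 0) ∧
    (∀ j < i, ∀ k ≤ K j, x.2 (orbitMap S a ((T ^ k) (w j (f j).1))) = 0) ∧
    (∀ n ≤ i, x.2 (orbitMap S a (Finsupp.single n 1)) = 0) ∧
    (y ∉ LinearMap.range (orbitMap S a) → x.2 y = i)
  obtain ⟨f, hf⟩ : ∃ f : ℕ → ℕ × (E →L[𝕜] 𝕜), ∀ i, R i f (f i) := by
    refine (wellFounded_lt (α := ℕ)).exists_forall_rel R ?_ ?_
    · rintro i f f' x h ⟨h1, h2, h3, h4, h5, h6, h7⟩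
      refine ⟨h1, h2, fun j hj => ?_, h4, fun j hj => ?_, h6, h7⟩
      · rw [← h j hj]; exact h3 j hj
      · rw [← h j hj]; exact h5 j hj
    · intro i f _
      have hU : ∀ᶠ z in 𝓝 (0 : E), z ∈ B (K i) ∧ ∀ j ∈ Finset.range i,
          ∀ k ∈ Finset.range (K i + 1), ‖(f j).2 ((S ^ k) z)‖ < δ i := by
        refine Eventually.and (hB.1.mem_of_mem trivial) ((Finset.eventually_all _).2 fun j _ =>
          (Finset.eventually_all _).2 fun k _ => ?_)
        have h : Continuous fun z => ‖(f j).2 ((S ^ k) z)‖ := by fun_prop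
        exact h.continuousAt.eventually_lt continuousAt_const (by simpa using hδ i)
      obtain ⟨m, hmU, hmF⟩ := hD (listVector 𝕜 (ρ i).1) _ hU
        ((ρ i).2.2.map (Function.Embedding.subtype _)) (by simp) (K i) (δ i) (hδ i)
      let s : Set (ℕ →₀ 𝕜) := ((fun k => (T ^ k) (w i m)) '' Set.Iic (K i)) ∪
        (⋃ j ∈ Set.Iio i, (fun k => (T ^ k) (w j (f j).1)) '' Set.Iic (K j)) ∪
        ((fun n => Finsupp.single n 1) '' Set.Iic i)
      have hs : s.Finite := (((Set.finite_Iic _).image _).union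
        ((Set.finite_Iio i).biUnion fun j _ => (Set.finite_Iic _).image _)).union
        ((Set.finite_Iic _).image _)
      obtain ⟨h, h0, hy⟩ := exists_functional_vanishing (S := S) (a := a) hs y i
      refine ⟨(m, h), hmU.1, ?_, ?_, ?_, ?_, ?_, hy⟩
      · intro g hg k hk
        exact hmF g (Finset.mem_map_of_mem _ hg) k hk
      · intro j hj k hk
        rw [orbitMap_finsuppShift_pow]
        exact (hmU.2 j (Finset.mem_range.2 hj) k (Finset.mem_range.2 (by omega))).le
      · exact fun k hk => h0 _ (Or.inl (Or.inl ⟨k, hk, rfl⟩))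
      · exact fun j hj k hk => h0 _ (Or.inl (Or.inr (Set.mem_biUnion hj ⟨k, hk, rfl⟩)))
      · exact fun n hn => h0 _ (Or.inr ⟨n, hn, rfl⟩)
  let g : NullFunctionals S a := ⟨fun i => (f i).2, fun u => by
    induction u using Finsupp.induction_linear with
    | zero => simp
    | add u v hu hv =>
      filter_upwards [hu, hv] with i hi hi'
      rw [map_add, map_add, hi, hi', add_zero]
    | single n c =>
      filter_upwards [eventually_ge_atTop n] with i hi
      have := (hf i).2.2.2.2.2.1 n hi
      rw [orbitMap_single, one_smul] at this
      rw [orbitMap_single, map_smul, this, smul_zero]⟩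
  have hg : ∀ i, ∀ k ≤ K i, ‖g.eval ((T ^ k) (w i (f i).1))‖ ≤ δ i := by
    intro i k hk
    refine (BoundedContinuousFunction.norm_le (hδ i).le).2 fun j => ?_
    rw [NullFunctionals.eval_apply]
    rcases lt_trichotomy j i with h | rfl | h
    · exact (hf i).2.2.1 j h k hk
    · rw [show g.1 j = (f j).2 from rfl, (hf j).2.2.2.1 k hk, norm_zero]
      exact (hδ j).le
    · rw [show g.1 j = (f j).2 from rfl, (hf j).2.2.2.2.1 i h k hk, norm_zero]
      exact (hδ i).le
  refine ⟨g, fun hy i => (hf i).2.2.2.2.2.2 hy, ?_⟩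
  intro v U hU F hF K₀ ε hε
  -- A requirement whose target is near `v` and whose `K` is large yields the density at `v`.
  obtain ⟨V, hV, hVU⟩ := exists_nhds_zero_half hU
  obtain ⟨l, hlV, hlF⟩ := exists_listVector_near v hV F K₀ (half_pos hε)
  obtain ⟨N₁, -, hN₁⟩ := hB.1.mem_iff.1 hV
  obtain ⟨N₂, hN₂⟩ := exists_nat_one_div_lt (half_pos hε)
  obtain ⟨i, hi⟩ := hρ (l, max K₀ (max N₁ N₂), F.subtype (· ∈ D))
  have hKi : K i = max K₀ (max N₁ N₂) := by simp only [K, hi]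
  have hδi : δ i ≤ ε / 2 := by
    refine le_trans ?_ hN₂.le
    refine Nat.one_div_le_one_div ?_
    rw [hKi]; exact (le_max_right _ _).trans (le_max_right _ _)
  have hw : Finsupp.single (f i).1 1 - v = w i (f i).1 + (listVector 𝕜 l - v) := by
    simp only [w, hi]; abel
  refine ⟨(f i).1, ?_, fun g' hg' k hk => ?_⟩
  · rw [hw, map_add]
    refine hVU _ (hN₁ (hB.2 ?_ (hf i).1)) _ hlV
    rw [hKi]; exact (le_max_left _ _).trans (le_max_right _ _)
  · have hkK : k ≤ K i := hKi ▸ hk.trans (le_max_left _ _)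
    rw [hw, map_add, map_add]
    refine (norm_add_le _ _).trans ?_
    rw [← add_halves ε]
    refine add_le_add (le_trans ?_ hδi) (hlF g' hg' k hk)
    rcases hF hg' with rfl | hgD
    · exact hg i k hkK
    · exact (hf i).2.1 ⟨g', hgD⟩ (by rw [hi]; simpa using hg') k hkK

/-- Without additional seminorms, density of the orbit is density in `E`. -/
theorem hasDenseOrbit_empty (ha : DenseRange fun n : ℕ => (S ^ n) a) :
    HasDenseOrbit (∅ : Set (NullFunctionals S a)) := by
  intro v U hU F hF K ε hε
  have hnhds : {z | z - orbitMap S a v ∈ U} ∈ 𝓝 (orbitMap S a v) := by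
    have h : Continuous fun z : E => z - orbitMap S a v := by fun_prop
    exact h.continuousAt.preimage_mem_nhds (by simpa using hU)
  obtain ⟨_, hz, n, rfl⟩ := mem_closure_iff_nhds.1 (ha (orbitMap S a v)) _ hnhds
  refine ⟨n, by simpa [orbitMap_single] using hz, fun g hg => absurd (hF hg) (by simp)⟩

/-- There is a family that excludes all vectors outside the span and keeps the orbit dense, provided
that `E` can be enumerated along a well-order with countable initial segments. -/
theorem exists_hasDenseOrbit [ContinuousSMul 𝕜 E] [FirstCountableTopology E] [SeparatingDual 𝕜 E]
    {ι : Type*} [LinearOrder ι] [WellFoundedLT ι] (hι : ∀ i : ι, (Set.Iio i).Countable)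
    {y : ι → E} (hy : Function.Surjective y) (ha : DenseRange fun n : ℕ => (S ^ n) a) :
    ∃ D : Set (NullFunctionals S a), HasDenseOrbit D ∧
      ∀ z, z ∉ LinearMap.range (orbitMap S a) → ∃ g ∈ D, ∀ i : ℕ, g.1 i z = i := by
  have : Nonempty (NullFunctionals S a) := ⟨⟨0, by simp⟩⟩
  obtain ⟨D, hD, hDy⟩ := exists_set_of_finite_character hι (HasDenseOrbit (S := S) (a := a))
    (fun i g => y i ∉ LinearMap.range (orbitMap S a) → ∀ n : ℕ, g.1 n (y i) = n)
    (hasDenseOrbit_empty ha)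
    (fun D D' h hD' v U hU F hF => hD' v U hU F (hF.trans h))
    (fun D h v U hU F hF => h F hF F.finite_toSet v U hU F subset_rfl)
    (fun D hDc hD i => hD.exists_insert hDc (y i))
  refine ⟨D, hD, fun z hz => ?_⟩
  obtain ⟨i, rfl⟩ := hy z
  obtain ⟨g, hg, h⟩ := hDy i
  exact ⟨g, hg, h hz⟩

end

/-! ### The complete topology -/

section
variable {𝕜 E : Type*} [RCLike 𝕜] [AddCommGroup E] [Module 𝕜 E]

/-- The linear map that induces the topology given by `D`: its components are `orbitMap S a` and, for
`g ∈ D` and `k ∈ ℕ`, the bounded sequence `g.eval (finsuppShift ^ k u)`. -/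
noncomputable def finsuppEmbedding [TopologicalSpace E] {S : E →L[𝕜] E} {a : E}
    (D : Set (NullFunctionals S a)) :
    (ℕ →₀ 𝕜) →ₗ[𝕜] E × (D × ℕ → ℕ →ᵇ 𝕜) :=
  (orbitMap S a).prod (LinearMap.pi fun p => p.1.1.eval ∘ₗ (finsuppShift 𝕜 ^ p.2))

/-- If `D` excludes all vectors outside the span, the range is described by closed conditions: they
force `i ↦ g i z.1` to be a bounded sequence for all `g ∈ D`, so that `z.1` lies in the span. -/
theorem range_finsuppEmbedding [TopologicalSpace E] {S : E →L[𝕜] E} {a : E}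
    {D : Set (NullFunctionals S a)}
    (hD : ∀ y, y ∉ LinearMap.range (orbitMap S a) → ∃ g ∈ D, ∀ i : ℕ, g.1 i y = i) :
    Set.range (finsuppEmbedding D) =
      {z | ∀ (p : D × ℕ) (i : ℕ), z.2 p i = p.1.1.1 i ((S ^ p.2) z.1)} := by
  ext z
  constructor
  · rintro ⟨u, rfl⟩ p i
    rw [← show (p.1.1.eval ((finsuppShift 𝕜 ^ p.2) u)) i = (finsuppEmbedding D u).2 p i from rfl,
      NullFunctionals.eval_apply, orbitMap_finsuppShift_pow]
    rfl
  · intro hz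
    obtain ⟨u, hu⟩ : z.1 ∈ LinearMap.range (orbitMap S a) := by
      by_contra hcon
      obtain ⟨g, hg, hgz⟩ := hD _ hcon
      obtain ⟨i, hi⟩ := exists_nat_gt ‖z.2 (⟨g, hg⟩, 0)‖
      refine (((z.2 (⟨g, hg⟩, 0)).norm_coe_le_norm i).trans_lt hi).ne ?_
      rw [hz (⟨g, hg⟩, 0) i]
      simp [hgz]
    refine ⟨u, Prod.ext hu (funext fun p => BoundedContinuousFunction.ext fun i => ?_)⟩
    rw [hz p i, ← hu, ← orbitMap_finsuppShift_pow]
    rfl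

theorem isClosed_range_finsuppEmbedding [TopologicalSpace E] {S : E →L[𝕜] E} {a : E}
    {D : Set (NullFunctionals S a)}
    (hD : ∀ y, y ∉ LinearMap.range (orbitMap S a) → ∃ g ∈ D, ∀ i : ℕ, g.1 i y = i) :
    IsClosed (Set.range (finsuppEmbedding D)) := by
  rw [range_finsuppEmbedding hD]
  simp only [Set.ofPred_forall]
  refine isClosed_iInter fun p => isClosed_iInter fun i => isClosed_eq ?_ ?_
  · have hi : Continuous fun b : ℕ →ᵇ 𝕜 => b i := by fun_prop
    exact hi.comp ((continuous_apply p).comp continuous_snd)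
  · exact (p.1.1.1 i).continuous.comp ((S ^ p.2).continuous.comp continuous_fst)

theorem HasDenseOrbit.finsuppEmbedding_mem_closure [TopologicalSpace E] [IsTopologicalAddGroup E]
    {S : E →L[𝕜] E} {a : E} {D : Set (NullFunctionals S a)} (hD : HasDenseOrbit D) (v : ℕ →₀ 𝕜) :
    finsuppEmbedding D v ∈
      closure (Set.range fun n : ℕ => finsuppEmbedding D (Finsupp.single n 1)) := by
  classical
  refine mem_closure_iff_nhds.2 fun N hN => ?_
  rw [nhds_prod_eq, mem_prod_iff] at hN
  obtain ⟨U, hU, W, hW, hUW⟩ := hN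
  rw [nhds_pi, Filter.mem_pi] at hW
  obtain ⟨I, hI, t, ht, hIt⟩ := hW
  have hball : ∀ᶠ ε in 𝓝[>] (0 : ℝ), ∀ p ∈ I,
      Metric.closedBall ((finsuppEmbedding D v).2 p) ε ⊆ t p := by
    refine (eventually_all_finite hI).2 fun p _ => ?_
    obtain ⟨r, hr, hrt⟩ := Metric.nhds_basis_closedBall.mem_iff.1 (ht p)
    filter_upwards [Ioo_mem_nhdsGT hr] with ε hε
    exact (Metric.closedBall_subset_closedBall hε.2.le).trans hrt
  obtain ⟨ε, hεt, hε⟩ := (hball.and self_mem_nhdsWithin).exists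
  have hU' : (fun z => z + (finsuppEmbedding D v).1) ⁻¹' U ∈ 𝓝 (0 : E) := by
    have h : Continuous fun z : E => z + (finsuppEmbedding D v).1 := by fun_prop
    exact h.continuousAt.preimage_mem_nhds (by simpa using hU)
  obtain ⟨K, hK⟩ := (hI.image Prod.snd).bddAbove
  obtain ⟨m, hm, hmF⟩ := hD v _ hU' (hI.toFinset.image fun p => p.1.1)
    (by
      intro g hg
      obtain ⟨p, -, rfl⟩ := Finset.mem_image.1 hg
      exact p.1.2) K ε hε
  refine ⟨_, hUW ⟨?_, hIt fun p hp => hεt p hp ?_⟩, m, rfl⟩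
  · simpa [finsuppEmbedding] using hm
  · rw [mem_closedBall_iff_norm]
    have := hmF p.1.1 (Finset.mem_image.2 ⟨p, hI.mem_toFinset.2 hp, rfl⟩) p.2 (hK ⟨p, hp, rfl⟩)
    rwa [map_sub, map_sub] at this

theorem exists_uniformSpace_finsupp [UniformSpace E] [IsUniformAddGroup E] [ContinuousSMul 𝕜 E]
    [T2Space E] [CompleteSpace E] [Module ℝ E] [IsScalarTower ℝ 𝕜 E] [LocallyConvexSpace ℝ E]
    {S : E →L[𝕜] E} {a : E} (hinj : Function.Injective (orbitMap S a))
    {D : Set (NullFunctionals S a)} (hdense : HasDenseOrbit D)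
    (hD : ∀ y, y ∉ LinearMap.range (orbitMap S a) → ∃ g ∈ D, ∀ i : ℕ, g.1 i y = i) :
    ∃ _ : UniformSpace (ℕ →₀ 𝕜),
      IsUniformAddGroup (ℕ →₀ 𝕜) ∧
      ContinuousSMul 𝕜 (ℕ →₀ 𝕜) ∧
      T2Space (ℕ →₀ 𝕜) ∧
      LocallyConvexSpace ℝ (ℕ →₀ 𝕜) ∧
      CompleteSpace (ℕ →₀ 𝕜) ∧
      IsStronglyOrbital 𝕜 (ℕ →₀ 𝕜) := by
  let f := finsuppEmbedding D
  have hf : Function.Injective f := fun u v h => hinj (congrArg Prod.fst h)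
  let _ : UniformSpace (ℕ →₀ 𝕜) := UniformSpace.comap f inferInstance
  have hind : IsUniformInducing f := ⟨rfl⟩
  have hcont : Continuous f := hind.uniformContinuous.continuous
  have hT : Continuous (finsuppShift 𝕜) := by
    rw [hind.isInducing.continuous_iff]
    -- The right shift acts on the first component as `S` and shifts the index `k` of the others.
    have hcomp : f ∘ finsuppShift 𝕜 = (fun z : E × (D × ℕ → ℕ →ᵇ 𝕜) =>
        (S z.1, fun p : D × ℕ => z.2 (p.1, p.2 + 1))) ∘ f := by
      funext u
      refine Prod.ext ?_ (funext fun p => ?_)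
      · have := orbitMap_finsuppShift_pow S a 1 u
        rwa [pow_one, pow_one] at this
      · change p.1.1.eval ((finsuppShift 𝕜 ^ p.2) (finsuppShift 𝕜 u)) =
          p.1.1.eval ((finsuppShift 𝕜 ^ (p.2 + 1)) u)
        rw [pow_succ, Module.End.mul_apply]
    rw [hcomp]
    refine Continuous.comp (.prodMk ?_ ?_) hcont
    · exact S.continuous.comp continuous_fst
    · fun_prop
  let T : (ℕ →₀ 𝕜) →L[𝕜] (ℕ →₀ 𝕜) := ⟨finsuppShift 𝕜, hT⟩
  have hTpow : ∀ n : ℕ, (T ^ n) (Finsupp.single 0 1) = Finsupp.single n 1 := by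
    intro n
    have : (T ^ n) (Finsupp.single 0 1) = (finsuppShift 𝕜 ^ n) (Finsupp.single 0 1) := by
      rw [FunLike.coe_pow_eq_iterate, Module.End.pow_apply]
      rfl
    rw [this, finsuppShift_pow_single, zero_add]
  refine ⟨inferInstance, IsUniformAddGroup.comap f, continuousSMul_induced f,
    T2Space.of_injective_continuous hf hcont, LocallyConvexSpace.induced (f.restrictScalars ℝ),
    hind.completeSpace (isClosed_range_finsuppEmbedding hD).isComplete, T, Finsupp.single 0 1,
    ?_, ?_⟩
  · intro v
    rw [hind.isInducing.closure_eq_preimage_closure_image, Set.mem_preimage, operatorOrbit,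
      ← Set.range_comp]
    simp only [Function.comp_def, hTpow]
    exact hdense.finsuppEmbedding_mem_closure v
  · refine eq_top_iff.2 fun u _ => ?_
    rw [← u.sum_single]
    refine Submodule.sum_mem _ fun n _ => ?_
    rw [← mul_one (u n), ← smul_eq_mul, ← Finsupp.smul_single]
    exact Submodule.smul_mem _ _ (Submodule.subset_span ⟨n, hTpow n⟩)

end

/-! ### The backward shift on the space of all sequences -/

section
variable (𝕜 : Type*) [RCLike 𝕜]

instance : SeparatingDual 𝕜 (ℕ → 𝕜) where
  exists_ne_zero' x hx := by
    obtain ⟨i, hi⟩ := Function.ne_iff.1 hx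
    exact ⟨ContinuousLinearMap.proj i, hi⟩

/-- The backward shift `(w₀, w₁, w₂, …) ↦ (w₁, w₂, w₃, …)`. -/
noncomputable def backwardShift : (ℕ → 𝕜) →L[𝕜] (ℕ → 𝕜) :=
  ContinuousLinearMap.pi fun n => ContinuousLinearMap.proj (n + 1)

variable {𝕜}
theorem backwardShift_pow_apply (n : ℕ) (w : ℕ → 𝕜) (k : ℕ) :
    (backwardShift 𝕜 ^ n) w k = w (n + k) := by
  induction n generalizing k with
  | zero => simp
  | succ n ih =>
    rw [pow_succ', mul_apply_eq_comp]
    change (backwardShift 𝕜 ^ n) w (k + 1) = _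
    rw [ih]
    congr 1
    omega

variable (𝕜) in
/-- The block of `a` at the positions `2 ^ c ≤ n < 2 ^ (c + 1)` starts like the member of a dense
sequence of `ℕ → 𝕜` whose index is the first component of `c` under the pairing function; so each
member recurs in arbitrarily long blocks. -/
theorem exists_denseRange_backwardShift :
    ∃ a : ℕ → 𝕜, DenseRange fun n : ℕ => (backwardShift 𝕜 ^ n) a := by
  let q := TopologicalSpace.denseSeq (ℕ → 𝕜)
  let a : ℕ → 𝕜 := fun n => q (Nat.log2 n).unpair.1 (n - 2 ^ Nat.log2 n)
  refine ⟨a, fun v => mem_closure_iff_nhds.2 fun N hN => ?_⟩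
  obtain ⟨U, hUN, hU, hvU⟩ := mem_nhds_iff.1 hN
  obtain ⟨j, hj⟩ := (TopologicalSpace.denseRange_denseSeq (ℕ → 𝕜)).exists_mem_open hU ⟨v, hvU⟩
  have hjN : U ∈ 𝓝 (q j) := hU.mem_nhds hj
  rw [nhds_pi, Filter.mem_pi] at hjN
  obtain ⟨I, hI, t, ht, hIt⟩ := hjN
  obtain ⟨K, hK⟩ := hI.bddAbove
  -- The second component `K` only serves to make the block longer than `K`.
  let c := Nat.pair j K
  refine ⟨_, hUN (hIt fun k hk => ?_), 2 ^ c, rfl⟩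
  have hkc : k < 2 ^ c :=
    (hK hk).trans_lt ((Nat.right_le_pair j K).trans_lt Nat.lt_two_pow_self)
  have hlog : Nat.log2 (2 ^ c + k) = c := by
    rw [Nat.log2_eq_iff (by positivity), pow_succ]
    omega
  have : (backwardShift 𝕜 ^ 2 ^ c) a k = q j k := by
    rw [backwardShift_pow_apply]
    simp [a, hlog, c]
  change (backwardShift 𝕜 ^ 2 ^ c) a k ∈ t k
  rw [this]
  exact mem_of_mem_nhds (ht k)

/-- A vector of the kernel is a linear recurrence satisfied by `a`, hence by all sequences. -/
theorem orbitMap_backwardShift_injective {a : ℕ → 𝕜}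
    (ha : DenseRange fun n : ℕ => (backwardShift 𝕜 ^ n) a) :
    Function.Injective (orbitMap (backwardShift 𝕜) a) := by
  rw [injective_iff_map_eq_zero]
  intro u hu
  let ℓ : (ℕ → 𝕜) → 𝕜 := fun w => ∑ n ∈ u.support, u n * w n
  have hℓ : Continuous ℓ := by fun_prop
  have hzero : ℓ = fun _ => 0 := by
    refine ha.equalizer hℓ continuous_const (funext fun m => ?_)
    have := congrFun hu m
    rw [orbitMap, Finsupp.linearCombination_apply, Finsupp.sum, Finset.sum_apply,
      Pi.zero_apply] at this
    simpa only [Pi.smul_apply, smul_eq_mul, backwardShift_pow_apply, Function.comp_def, ℓ,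
      add_comm m] using this
  ext k
  have := congrFun hzero (Pi.single k 1)
  simpa [ℓ, Pi.single_apply] using this

theorem countable_Iio_ord_aleph_one (i : (Cardinal.aleph.{0} 1).ord.ToType) :
    (Set.Iio i).Countable := by
  rw [← Cardinal.le_aleph0_iff_set_countable, ← Cardinal.lt_aleph_one_iff]
  simpa using Cardinal.mk_Iio_lt i (by simp)

variable (𝕜) in
theorem exists_surjective_of_continuum_eq_aleph_one
    (hCH : (2 : Cardinal.{0}) ^ Cardinal.aleph0.{0} = Cardinal.aleph 1) :
    ∃ y : (Cardinal.aleph.{0} 1).ord.ToType → (ℕ → 𝕜), Function.Surjective y := by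
  let e : (ℕ → 𝕜) → (ℕ → ℝ × ℝ) := fun w n => (RCLike.re (w n), RCLike.im (w n))
  have he : Function.Injective e := fun w w' h => funext fun n => RCLike.ext
    (congrArg Prod.fst (congrFun h n)) (congrArg Prod.snd (congrFun h n))
  have hcard : Cardinal.mk (ℕ → ℝ × ℝ) = Cardinal.mk (Cardinal.aleph.{0} 1).ord.ToType := by
    rw [Cardinal.mk_ord_toType, ← hCH]
    simp [Cardinal.mk_real]
  obtain ⟨e'⟩ := Cardinal.eq.1 hcard
  exact ⟨Function.invFun (e' ∘ e), Function.invFun_surjective (e'.injective.comp he)⟩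

end

theorem theorem1p15 (𝕜 : Type*) [RCLike 𝕜]
    (hCH : (2 : Cardinal.{0}) ^ Cardinal.aleph0.{0} = Cardinal.aleph 1) :
    Module.rank 𝕜 (ℕ →₀ 𝕜) = Cardinal.aleph0 ∧
    ∃ _ : UniformSpace (ℕ →₀ 𝕜),
      IsUniformAddGroup (ℕ →₀ 𝕜) ∧
      ContinuousSMul 𝕜 (ℕ →₀ 𝕜) ∧
      T2Space (ℕ →₀ 𝕜) ∧
      LocallyConvexSpace ℝ (ℕ →₀ 𝕜) ∧
      CompleteSpace (ℕ →₀ 𝕜) ∧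
      IsStronglyOrbital 𝕜 (ℕ →₀ 𝕜) ∧
      ¬ HasInvariantSubsetProperty 𝕜 (ℕ →₀ 𝕜) := by
  refine ⟨by simp, ?_⟩
  obtain ⟨a, ha⟩ := exists_denseRange_backwardShift 𝕜
  obtain ⟨y, hy⟩ := exists_surjective_of_continuum_eq_aleph_one 𝕜 hCH
  obtain ⟨D, hdense, hD⟩ := exists_hasDenseOrbit
    countable_Iio_ord_aleph_one hy ha
  obtain ⟨u, h₁, h₂, h₃, h₄, h₅, h₆⟩ :=
    exists_uniformSpace_finsupp (E := ℕ → 𝕜) (S := backwardShift 𝕜) (a := a) (D := D)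
      (orbitMap_backwardShift_injective ha) hdense hD
  exact ⟨u, h₁, h₂, h₃, h₄, h₅, h₆, h₆.not_hasInvariantSubsetProperty⟩
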